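/- **Conventions.** All entropies and mutual informations are in bits, and $\oplus$ is addition modulo 2. A binary-input channel $W$ has input alphabet $\{0,1\}$, a finite output alphabet $\mathcal Y$ and transition probabilities $W(y\mid x)$. With $X\sim\mathrm{Bern}(1/2)$ and $Y$ the output of $W$ for the input $X$, put $I(W)=I(X;Y)$ and $H_0(W)=H(X\mid Y)$. A binary kernel of dimension $l$ is a matrix $T\in\mathbb F_2^{l\times l}$. Given $W$ and $T$, let $U=(U_1,\dots,U_l)$ be independent $\mathrm{Bern}(1/2)$ bits, $(X_1,\dots,X_l)=(U_1,\dots,U_l)\cdot T$, and let $Y_1^l=(Y_1,\dots,Y_l)$ be the outputs of $l$ independent uses of $W$ with inputs $X_1,\dots,X_l$. For $b\in\{1,\dots,l\}$ the virtual channel $W_b$ (with respect to $T$) is the binary-input channel with input $U_b$ and output $(Y_1^l,U_1^{b-1})$, i.e. $$W_b(y_1^l,u_1^{b-1}\mid u_b)=\frac1{2^{l-1}}\sum_{u_{b+1},\dots,u_l}\ \prod_{j=1}^l W\big(y_j\mid (u\cdot T)_j\big).$$ Applying kernels $T_{l_1},\dots,T_{l_m}$ successively and choosing the index $b_j\in\{1,\dots,l_j\}$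 at step $j$ gives $W_{b_1,\dots,b_m}=(W_{b_1,\dots,b_{m-1}})_{b_m}$. A kernel $T$ of dimension $l$ satisfies the polarization inequality with exponents $\alpha,\beta$ if for every binary-input channel $W$ with finite output alphabet, every finite (possibly empty) past sequence of binary kernels and indices $b_1,\dots,b_{m-1}$, and every $b\in\{1,\dots,l\}$, the channel $V=W_{b_1,\dots,b_{m-1}}$ and its virtual channel $V_b$ with respect to $T$ satisfy $$|I(V_b)-I(V)|\ \ge\ I(V)^{\alpha}\,(1-I(V))^{\beta}.$$ **Theorem.** Let $$T_2=\begin{pmatrix}1&0\\1&1\end{pmatrix},\qquad T_3=\begin{pmatrix}1&1&1\\1&0&1\\0&1&1\end{pmatrix}.$$ 1. $T_2$ satisfies the polarization inequality with $\alpha=1$, $\beta=2$. 2. $T_3$ satisfies the polarization inequality with $\alpha=\beta=2$. 3. For every binary-input channel $W$ with finite output alphabet, with $H_0=H_0(W)$ and $(X_1,X_2)=(U_1,U_2)\cdot T_2$, $$H(X_1\oplus X_2\mid Y_1^2)-H_0\ \ge\ H_0^2\,(1-H_0).$$ 4. For every binary-input channel $W$ with finite output alphabet, with $H_0=H_0(W)$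 and $(X_1,X_2,X_3)=(U_1,U_2,U_3)\cdot T_3$, $$|H(X_1\oplus X_2\oplus X_3\mid Y_1^3)-H_0|\ \ge\ H_0^2\,(1-H_0)^2,$$ $$|H(X_2\oplus X_3\mid Y_1^3,\,X_1\oplus X_2\oplus X_3)-H_0|\ \ge\ H_0^2\,(1-H_0)^2.$$ -/

import Mathlib

universe u

noncomputable section

/-! Information measures (in bits) of finitely valued random variables `A : Ω → α`
on a finite sample space `Ω` with probability mass function `μ : Ω → ℝ`. -/

open Classical in
/-- The probability `P(A = a)`. -/
def finProb {Ω α : Type*} [Fintype Ω] (μ : Ω → ℝ) (A : Ω → α) (a : α) : ℝ :=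
  ∑ ω, if A ω = a then μ ω else 0

/-- Conditional entropy `H(A | B) = - ∑ P(a, b) log₂ (P(a, b) / P(b))`.
Terms with `P(a, b) = 0` contribute `0`. -/
def condEntropy {Ω α β : Type*} [Fintype Ω] [Fintype α] [Fintype β]
    (μ : Ω → ℝ) (A : Ω → α) (B : Ω → β) : ℝ :=
  - ∑ a, ∑ b, finProb μ (fun ω => (A ω, B ω)) (a, b) *
      Real.logb 2 (finProb μ (fun ω => (A ω, B ω)) (a, b) / finProb μ B b)

/-- Mutual information `I(A; B) = ∑ P(a, b) log₂ (P(a, b) / (P(a) P(b)))`.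
Terms with `P(a, b) = 0` contribute `0`. -/
def mutualInfo {Ω α β : Type*} [Fintype Ω] [Fintype α] [Fintype β]
    (μ : Ω → ℝ) (A : Ω → α) (B : Ω → β) : ℝ :=
  ∑ a, ∑ b, finProb μ (fun ω => (A ω, B ω)) (a, b) *
      Real.logb 2 (finProb μ (fun ω => (A ω, B ω)) (a, b) / (finProb μ A a * finProb μ B b))

/-- A channel with binary input alphabet `ZMod 2` and finite output alphabet `Out`;
`prob x y` is the transition probability `W(y | x)`. -/
structure BinChannel : Type (u + 1) where
  Out : Type u
  [fintypeOut : Fintype Out]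
  prob : ZMod 2 → Out → ℝ
  prob_nonneg : ∀ x y, 0 ≤ prob x y
  sum_prob : ∀ x, ∑ y, prob x y = 1

attribute [instance] BinChannel.fintypeOut

/-- A binary kernel of dimension `l`. -/
abbrev BinKernel (l : ℕ) : Type := Matrix (Fin l) (Fin l) (ZMod 2)

namespace BinChannel


/-- The joint law of `(X, Y)`, with `X ~ Bern(1/2)` and `Y` the channel output. -/
def jointLaw (W : BinChannel.{u}) : ZMod 2 × W.Out → ℝ :=
  fun ω => 1 / 2 * W.prob ω.1 ω.2

/-- `I(W) = I(X; Y)` for the uniform input distribution. -/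
def info (W : BinChannel.{u}) : ℝ := mutualInfo W.jointLaw Prod.fst Prod.snd

/-- `H(X | Y)` for the uniform input distribution. -/
def inputEntropy (W : BinChannel.{u}) : ℝ := condEntropy W.jointLaw Prod.fst Prod.snd

/-- The joint law of `(U, Y)`, where `U = (U_1, …, U_l)` are independent `Bern(1/2)` bits and
`Y = (Y_1, …, Y_l)` are the outputs of `l` independent uses of `W` with inputs `X = U ⬝ T`. -/
def vectorLaw (W : BinChannel.{u}) {l : ℕ} (T : BinKernel l) :
    (Fin l → ZMod 2) × (Fin l → W.Out) → ℝ :=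
  fun ω => (1 / 2) ^ l * ∏ j, W.prob (Matrix.vecMul ω.1 T j) (ω.2 j)

/-- The transition probability `W_i(y, u_{<i} | a)` of the `i`-th virtual channel:
`U_i = a` is the input, `(Y, U_{<i})` is the output, and the remaining bits are uniform. -/
def subProb (W : BinChannel.{u}) {l : ℕ} (T : BinKernel l) (i : Fin l) (a : ZMod 2)
    (z : (Fin l → W.Out) × ({j : Fin l // j < i} → ZMod 2)) : ℝ :=
  ∑ u : Fin l → ZMod 2,
    if u i = a ∧ (fun j : {j : Fin l // j < i} => u j) = z.2 then
      (1 / 2) ^ (l - 1) * ∏ j, W.prob (Matrix.vecMul u T j) (z.1 j)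
    else 0

theorem subProb_nonneg (W : BinChannel.{u}) {l : ℕ} (T : BinKernel l) (i : Fin l) (a : ZMod 2)
    (z : (Fin l → W.Out) × ({j : Fin l // j < i} → ZMod 2)) : 0 ≤ W.subProb T i a z := by
  refine Finset.sum_nonneg fun u _ => ?_
  split_ifs
  · exact mul_nonneg (by positivity) (Finset.prod_nonneg fun j _ => W.prob_nonneg _ _)
  · exact le_rfl

theorem sum_prod_prob (W : BinChannel.{u}) {l : ℕ} (x : Fin l → ZMod 2) :
    ∑ y : Fin l → W.Out, ∏ j, W.prob (x j) (y j) = 1 := by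
  classical
  rw [← Fintype.piFinset_univ, ← Finset.prod_univ_sum]
  simp [W.sum_prob]

theorem card_coord_eq {l : ℕ} (i : Fin l) (a : ZMod 2) :
    (Finset.univ.filter fun u : Fin l → ZMod 2 => u i = a).card = 2 ^ (l - 1) := by
  have h : (Finset.univ.filter fun u : Fin l → ZMod 2 => u i = a) =
      Fintype.piFinset (fun j => if j = i then {a} else Finset.univ) := by
    ext u
    simp only [Finset.mem_filter, Finset.mem_univ, true_and, Fintype.mem_piFinset]
    constructor
    · intro hu j
      by_cases hj : j = i
      · subst hj; simp [hu]
      · simp [hj]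
    · intro hu
      simpa using hu i
  rw [h, Fintype.card_piFinset]
  have h2 : ∀ j : Fin l, (if j = i then ({a} : Finset (ZMod 2)) else Finset.univ).card =
      if j = i then 1 else 2 := by
    intro j
    split_ifs
    · simp
    · simp [ZMod.card]
  simp only [h2]
  rw [Finset.prod_ite]
  simp [Finset.filter_ne']

theorem sum_subProb (W : BinChannel.{u}) {l : ℕ} (T : BinKernel l) (i : Fin l) (a : ZMod 2) :
    ∑ z, W.subProb T i a z = 1 := by
  have key : ∀ u : Fin l → ZMod 2,
      (∑ z : (Fin l → W.Out) × ({j : Fin l // j < i} → ZMod 2),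
        if u i = a ∧ (fun j : {j : Fin l // j < i} => u j) = z.2 then
          (1 / 2 : ℝ) ^ (l - 1) * ∏ j, W.prob (Matrix.vecMul u T j) (z.1 j)
        else 0) = if u i = a then (1 / 2 : ℝ) ^ (l - 1) else 0 := by
    intro u
    by_cases hu : u i = a
    · rw [Fintype.sum_prod_type]
      simp only [hu, true_and, if_true, Finset.sum_ite_eq, Finset.mem_univ]
      rw [← Finset.mul_sum, sum_prod_prob, mul_one]
    · simp [hu]
  unfold subProb
  rw [Finset.sum_comm]
  simp only [key]
  rw [← Finset.sum_filter, Finset.sum_const, card_coord_eq]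
  simp

/-- The `i`-th virtual channel obtained from `W` by one application of the kernel `T`. -/
def sub (W : BinChannel.{u}) {l : ℕ} (T : BinKernel l) (i : Fin l) : BinChannel.{u} where
  Out := (Fin l → W.Out) × ({j : Fin l // j < i} → ZMod 2)
  prob := W.subProb T i
  prob_nonneg := W.subProb_nonneg T i
  sum_prob := W.sum_subProb T i

/-- The channel `W_{b_1, …, b_m}` of the polarization tree: starting from `W`, the kernels
`T_{l_1}, …, T_{l_m}` are applied successively, choosing the virtual channel `b_j` at step `j`. -/
def descend (W : BinChannel.{u}) (path : List (Σ l : ℕ, BinKernel l × Fin l)) : BinChannel.{u} :=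
  path.foldl (fun V s => V.sub s.2.1 s.2.2) W

end BinChannel

/-- The polarization inequality for the kernel `T` with exponents `α, β`: for every channel `W`,
every past sequence of kernels and indices, with `V = W_{b_1, …, b_{m-1}}`, and every index `b`
of `T`, `|I(V_b) - I(V)| ≥ I(V) ^ α * (1 - I(V)) ^ β`. -/
def PolarizationInequality {l : ℕ} (T : BinKernel l) (α β : ℝ) : Prop :=
  ∀ (W : BinChannel.{u}) (past : List (Σ l : ℕ, BinKernel l × Fin l)) (b : Fin l),
    |((W.descend past).sub T b).info - (W.descend past).info| ≥
      (W.descend past).info ^ α * (1 - (W.descend past).info) ^ β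

/-- Arikan's kernel. -/
def kernelT2 : BinKernel 2 := !![1, 0; 1, 1]

/-- The `3 × 3` kernel. -/
def kernelT3 : BinKernel 3 := !![1, 1, 1; 1, 0, 1; 0, 1, 1]

/-- The channel inputs `X = U ⬝ T`, as random variables on the sample space of `(U, Y)`. -/
def chanInput {l : ℕ} {Y : Type*} (T : BinKernel l) (j : Fin l)
    (ω : (Fin l → ZMod 2) × (Fin l → Y)) : ZMod 2 :=
  Matrix.vecMul ω.1 T j

end

/-! Given its output `y`, a channel acts like a binary symmetric channel with bias `r_y`, so `I(W)`
is the average of `C(r_y)`, where `C` is `symCapacity`. The bias of a sum of independent bits is the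
product of their biases. Hence, writing I for `info`, the sums of two and of three channel inputs
carry informations J₂ = E C(r r') (`xorInfo`) and J₃ = E C(r r' r'') (`tripleXorInfo`). By the chain
rule the virtual channels have informations J₂ and 2I - J₂ for `kernelT2`, and J₃, I + J₂ - J₃ and
2I - J₂ for `kernelT3`. It remains to bound the gaps I - J₂ and J₂ - J₃ from below.

`C` is a power series in r² without constant term, with nonnegative coefficients of sum at most 1.
This gives C(rs) ≤ r² C(s) (`symCapacity_mul_le`) and, by Chebyshev's sum inequality, C(r) C(s) ≤
C(rs) (`symCapacity_mul_symCapacity_le`). With M = E r² it follows that J₂ ≤ M I, J₃ ≤ M J₂ and I² ≤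
J₂. The bound (1 - C(r))² ≤ 1 - r² and Jensen give M ≤ 1 - (1 - I)² (`biasSq_le`). Hence I - J₂ ≥ I
(1 - I)² and J₂ - J₃ ≥ J₂ (1 - I)² ≥ I² (1 - I)². These hold for every channel, so the past sequence
plays no role. -/

noncomputable section

/-! ### The capacity function of binary symmetric channels -/

/-- `1 - h₂((1 - r) / 2)` in bits: the capacity of a binary symmetric channel whose
correlation coefficient is `r`. -/
def symCapacity (r : ℝ) : ℝ :=
  ((1 + r) * Real.log (1 + r) + (1 - r) * Real.log (1 - r)) / (2 * Real.log 2)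

/-- The coefficient of `r ^ (2 * n + 2)` in the power series of `symCapacity`. -/
def symCapacityCoeff (n : ℕ) : ℝ := 1 / ((n + 1) * (2 * n + 1)) / (2 * Real.log 2)

theorem symCapacityCoeff_nonneg (n : ℕ) : 0 ≤ symCapacityCoeff n := by
  have := Real.log_pos one_lt_two
  unfold symCapacityCoeff
  positivity

theorem symCapacity_one : symCapacity 1 = 1 := by
  have := Real.log_pos one_lt_two
  have h : (1 : ℝ) + 1 = 2 := by norm_num
  simp only [symCapacity, h, sub_self, zero_mul, add_zero]
  exact div_self (by positivity)

theorem symCapacity_neg (r : ℝ) : symCapacity (-r) = symCapacity r := by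
  simp only [symCapacity, sub_neg_eq_add, ← sub_eq_add_neg]
  ring

theorem symCapacity_abs (r : ℝ) : symCapacity |r| = symCapacity r := by
  rcases abs_choice r with h | h <;> rw [h]
  exact symCapacity_neg r

/-- The numerator equals r (log(1 + r) - log(1 - r)) + log(1 - r²), and both logarithmic terms have
known series. -/
theorem hasSum_symCapacity {r : ℝ} (hr : |r| < 1) :
    HasSum (fun n : ℕ => symCapacityCoeff n * (r ^ 2) ^ (n + 1)) (symCapacity r) := by
  have hr2 : |r ^ 2| < 1 := by
    rw [abs_pow]; exact pow_lt_one₀ (abs_nonneg _) hr two_ne_zero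
  obtain ⟨hl, hu⟩ := abs_lt.mp hr
  have h1 := Real.hasSum_pow_div_log_of_abs_lt_one hr2
  have h2 := Real.hasSum_log_sub_log_of_abs_lt_one hr
  have h3 := ((h2.mul_left r).sub h1).div_const (2 * Real.log 2)
  have e : 1 - r ^ 2 = (1 + r) * (1 - r) := by ring
  rw [e, Real.log_mul (by linarith) (by linarith)] at h3
  have hv : symCapacity r = (r * (Real.log (1 + r) - Real.log (1 - r))
      - -(Real.log (1 + r) + Real.log (1 - r))) / (2 * Real.log 2) := by
    unfold symCapacity
    ring
  rw [hv]
  suffices hf : ∀ n : ℕ, symCapacityCoeff n * (r ^ 2) ^ (n + 1) = (r * (2 * (1 / (2 * n + 1)) *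
      r ^ (2 * n + 1)) - (r ^ 2) ^ (n + 1) / (n + 1)) / (2 * Real.log 2) by
    simpa only [hf] using h3
  intro n
  have : (2 * (n : ℝ) + 1) ≠ 0 := by positivity
  have : ((n : ℝ) + 1) ≠ 0 := by positivity
  have : Real.log 2 ≠ 0 := (Real.log_pos one_lt_two).ne'
  unfold symCapacityCoeff
  field_simp
  ring

theorem symCapacity_nonneg_of_lt {r : ℝ} (hr : |r| < 1) : 0 ≤ symCapacity r :=
  (hasSum_symCapacity hr).nonneg fun n =>
    mul_nonneg (symCapacityCoeff_nonneg n) (by positivity)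

/-- The form in nats of `h₂(p) ≤ 2 √(p (1 - p))`, parametrised by `u = √(p / (1 - p))`. -/
theorem entropy_ratio_le {u : ℝ} (hu : 0 < u) (hu1 : u ≤ 1) :
    -u * Real.log u + (u + u⁻¹) / 2 * Real.log (1 + u ^ 2) ≤ Real.log 2 := by
  have hd : ∀ x ∈ Set.Ioi (0 : ℝ), HasDerivAt
      (fun u : ℝ => -u * Real.log u + (u + u⁻¹) / 2 * Real.log (1 + u ^ 2))
      (-Real.log x - (1 - x ^ 2) / (2 * x ^ 2) * Real.log (1 + x ^ 2)) x := by
    intro x hx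
    have hx0 : x ≠ 0 := (Set.mem_Ioi.mp hx).ne'
    have hx1 : 1 + x ^ 2 ≠ 0 := by positivity
    have h1 := ((hasDerivAt_id x).neg).mul (Real.hasDerivAt_log hx0)
    have h2 := ((hasDerivAt_id x).add (hasDerivAt_inv hx0)).div_const 2
    have h3 := (((hasDerivAt_id x).pow 2).const_add 1).log hx1
    refine (h1.add (h2.mul h3)).congr_deriv ?_
    simp
    field_simp
    ring
  have hmono : MonotoneOn
      (fun u : ℝ => -u * Real.log u + (u + u⁻¹) / 2 * Real.log (1 + u ^ 2)) (Set.Ioc 0 1) := by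
    refine monotoneOn_of_deriv_nonneg (convex_Ioc 0 1)
      (fun x hx => (hd x hx.1).continuousAt.continuousWithinAt)
      (fun x hx => ?_) (fun x hx => ?_)
    · rw [interior_Ioc] at hx
      exact (hd x hx.1).differentiableAt.differentiableWithinAt
    · rw [interior_Ioc] at hx
      rw [(hd x hx.1).deriv]
      have hx0 : 0 < x := hx.1
      -- Two uses of log t ≤ t - 1 bound the two terms of the derivative by ±(1 - x²)/2, which
      -- cancel.
      have h1 : Real.log (1 + x ^ 2) ≤ x ^ 2 := by
        have := Real.log_le_sub_one_of_pos (show 0 < 1 + x ^ 2 by positivity)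
        linarith
      have h2 : 2 * Real.log x ≤ x ^ 2 - 1 := by
        have := Real.log_le_sub_one_of_pos (show 0 < x ^ 2 by positivity)
        rwa [Real.log_pow] at this
      have h3 : 0 ≤ (1 - x ^ 2) / (2 * x ^ 2) := by
        apply div_nonneg _ (by positivity)
        nlinarith [hx.2]
      have h4 := mul_le_mul_of_nonneg_left h1 h3
      have h5 : (1 - x ^ 2) / (2 * x ^ 2) * x ^ 2 = (1 - x ^ 2) / 2 := by
        field_simp
      linarith
  have := hmono ⟨hu, hu1⟩ ⟨one_pos, le_refl 1⟩ hu1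
  norm_num at this
  simpa using this

/-- `h₂(p)² ≤ 4 p (1 - p)` in terms of `r = 1 - 2 p`. -/
theorem one_sub_symCapacity_sq_le {r : ℝ} (hr : |r| ≤ 1) :
    (1 - symCapacity r) ^ 2 ≤ 1 - r ^ 2 := by
  rw [← symCapacity_abs, ← sq_abs r]
  generalize hs : |r| = s at hr
  have hs0 : 0 ≤ s := hs ▸ abs_nonneg r
  rcases hr.eq_or_lt with rfl | hlt
  · simp [symCapacity_one]
  have hl2 := Real.log_pos one_lt_two
  -- With p = (1 - s)/2 this is √(p / (1 - p)), and u / (1 - s) = 1 / √(1 - s²).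
  set u := Real.sqrt ((1 - s) / (1 + s)) with hu
  have hq : 0 < (1 - s) / (1 + s) := div_pos (by linarith) (by linarith)
  have hu0 : 0 < u := Real.sqrt_pos.mpr hq
  have husq : u ^ 2 = (1 - s) / (1 + s) := Real.sq_sqrt hq.le
  have hu1 : u ≤ 1 := by
    rw [hu, Real.sqrt_le_one, div_le_one (by linarith)]
    linarith
  have key := entropy_ratio_le hu0 hu1
  have hlogu : Real.log u = (Real.log (1 - s) - Real.log (1 + s)) / 2 := by
    rw [hu, Real.log_sqrt hq.le, Real.log_div (by linarith) (by linarith)]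
  have h1u : 1 + u ^ 2 = 2 / (1 + s) := by
    rw [husq]; field_simp; ring
  rw [h1u, Real.log_div two_ne_zero (by linarith), hlogu] at key
  have hinv : u⁻¹ = u * ((1 + s) / (1 - s)) := by
    have h1 : (1 - s) ≠ 0 := by linarith
    have h2 : (1 + s) ≠ 0 := by linarith
    field_simp
    rw [husq]
    field_simp
  have hform : -u * ((Real.log (1 - s) - Real.log (1 + s)) / 2)
      + (u + u⁻¹) / 2 * (Real.log 2 - Real.log (1 + s))
      = u / (1 - s) * (Real.log 2 * (1 - symCapacity s)) := by
    rw [hinv]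
    have h1 : (1 - s) ≠ 0 := by linarith
    unfold symCapacity
    field_simp
    ring
  rw [hform] at key
  have h1 : u / (1 - s) * (1 - symCapacity s) ≤ 1 := by
    refine le_of_mul_le_mul_left ?_ hl2
    linarith
  have hcap : symCapacity s ≤ 1 := by
    have h3 : (1 + s) * Real.log (1 + s) + (1 - s) * Real.log (1 - s) ≤ 2 * Real.log 2 := by
      have h4 : Real.log (1 + s) ≤ Real.log 2 := Real.log_le_log (by linarith) (by linarith)
      have h5 : Real.log (1 - s) ≤ Real.log 2 := Real.log_le_log (by linarith) (by linarith)
      nlinarith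
    exact (div_le_one (by positivity)).mpr h3
  have h2 : (u / (1 - s) * (1 - symCapacity s)) ^ 2 ≤ 1 := by
    refine pow_le_one₀ (mul_nonneg (div_nonneg hu0.le (by linarith)) (by linarith)) h1
  have h3 : (u / (1 - s) * (1 - symCapacity s)) ^ 2
      = (1 - symCapacity s) ^ 2 / (1 - s ^ 2) := by
    rw [mul_pow, div_pow, husq]
    have h1 : (1 - s) ≠ 0 := by linarith
    have h2 : (1 + s) ≠ 0 := by linarith
    have h3 : 1 - s ^ 2 ≠ 0 := by
      rw [show 1 - s ^ 2 = (1 - s) * (1 + s) by ring]; exact mul_ne_zero h1 h2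
    field_simp
    ring
  rw [h3, div_le_one (by nlinarith)] at h2
  exact h2

theorem symCapacity_le_one {r : ℝ} (hr : |r| ≤ 1) : symCapacity r ≤ 1 := by
  obtain ⟨hl, hu⟩ := abs_le.mp hr
  have hl2 := Real.log_pos one_lt_two
  have h : ∀ x : ℝ, 0 ≤ x → x ≤ 2 → x * Real.log x ≤ x * Real.log 2 := by
    intro x hx hx2
    rcases hx.eq_or_lt with rfl | hx
    · simp
    · exact mul_le_mul_of_nonneg_left (Real.log_le_log hx hx2) hx.le
  have h1 := h (1 + r) (by linarith) (by linarith)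
  have h2 := h (1 - r) (by linarith) (by linarith)
  exact (div_le_one (by positivity)).mpr (by linarith)

theorem symCapacity_nonneg {r : ℝ} (hr : |r| ≤ 1) : 0 ≤ symCapacity r := by
  rcases hr.eq_or_lt with h | h
  · rw [← symCapacity_abs, h, symCapacity_one]; exact zero_le_one
  · exact symCapacity_nonneg_of_lt h

/-- For r < 1 a partial sum of the series is at most C(r) ≤ 1; let r tend to 1 from below. -/
theorem sum_symCapacityCoeff_le_one (s : Finset ℕ) : ∑ n ∈ s, symCapacityCoeff n ≤ 1 := by
  have hc : Filter.Tendsto (fun r : ℝ => ∑ n ∈ s, symCapacityCoeff n * (r ^ 2) ^ (n + 1))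
      (nhdsWithin 1 (Set.Iio 1)) (nhds (∑ n ∈ s, symCapacityCoeff n * ((1 : ℝ) ^ 2) ^ (n + 1))) :=
    (Continuous.tendsto (by fun_prop) 1).mono_left nhdsWithin_le_nhds
  simp only [one_pow, mul_one] at hc
  refine le_of_tendsto hc ?_
  filter_upwards [Ioo_mem_nhdsLT (show (0 : ℝ) < 1 by norm_num)] with r hr
  have hr1 : |r| < 1 := by rw [abs_of_pos hr.1]; exact hr.2
  exact (sum_le_hasSum s (fun n _ => mul_nonneg (symCapacityCoeff_nonneg n) (by positivity))
    (hasSum_symCapacity hr1)).trans (symCapacity_le_one hr1.le)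

theorem summable_symCapacityCoeff : Summable symCapacityCoeff :=
  summable_of_sum_le symCapacityCoeff_nonneg sum_symCapacityCoeff_le_one

theorem tsum_symCapacityCoeff_le_one : ∑' n, symCapacityCoeff n ≤ 1 :=
  summable_symCapacityCoeff.tsum_le_of_sum_le sum_symCapacityCoeff_le_one

theorem abs_mul_le_one {r s : ℝ} (hr : |r| ≤ 1) (hs : |s| ≤ 1) : |r * s| ≤ 1 := by
  rw [abs_mul]; exact mul_le_one₀ hr (abs_nonneg s) hs

/-- Termwise in the power series: every exponent of r² is at least 1, so one factor r² comes out and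
the other powers are at most 1. -/
theorem symCapacity_mul_le {r s : ℝ} (hr : |r| ≤ 1) (hs : |s| ≤ 1) :
    symCapacity (r * s) ≤ r ^ 2 * symCapacity s := by
  rcases hr.eq_or_lt with h | h
  · rw [← symCapacity_abs, abs_mul, h, one_mul, symCapacity_abs, ← sq_abs, h]
    simp
  have hr2 : r ^ 2 ≤ 1 := by rw [← sq_abs]; exact pow_le_one₀ (abs_nonneg r) hr
  have hpow : ∀ n : ℕ, (r ^ 2) ^ (n + 1) ≤ r ^ 2 := fun n => by
    rw [pow_succ]
    exact mul_le_of_le_one_left (sq_nonneg r) (pow_le_one₀ (sq_nonneg r) hr2)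
  -- At |s| = 1 the series of C(s) is not available; the bound on the sum of the coefficients
  -- replaces it.
  rcases hs.eq_or_lt with hs1 | hs1
  · have e : symCapacity s = 1 := by rw [← symCapacity_abs, hs1, symCapacity_one]
    rw [e, mul_one, ← symCapacity_abs, abs_mul, hs1, mul_one, symCapacity_abs]
    calc symCapacity r ≤ r ^ 2 * ∑' n, symCapacityCoeff n := by
          refine hasSum_le (fun n => ?_) (hasSum_symCapacity h)
            (summable_symCapacityCoeff.hasSum.mul_left (r ^ 2))
          rw [mul_comm]
          exact mul_le_mul_of_nonneg_right (hpow n) (symCapacityCoeff_nonneg n)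
      _ ≤ r ^ 2 := mul_le_of_le_one_right (sq_nonneg r) tsum_symCapacityCoeff_le_one
  · have hrs : |r * s| < 1 := by
      rw [abs_mul]; exact mul_lt_one_of_nonneg_of_lt_one_left (abs_nonneg r) h hs
    refine hasSum_le (fun n => ?_) (hasSum_symCapacity hrs) ((hasSum_symCapacity hs1).mul_left _)
    have h1 := mul_le_mul_of_nonneg_right (hpow n)
      (mul_nonneg (symCapacityCoeff_nonneg n) (pow_nonneg (sq_nonneg s) (n + 1)))
    calc _ = (r ^ 2) ^ (n + 1) * (symCapacityCoeff n * (s ^ 2) ^ (n + 1)) := by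
          rw [mul_pow r s 2, mul_pow (r ^ 2)]; ring
      _ ≤ _ := h1

/-- Chebyshev's sum inequality for the power series of `symCapacity`. -/
theorem symCapacity_mul_symCapacity_le {r s : ℝ} (hr : |r| ≤ 1) (hs : |s| ≤ 1) :
    symCapacity r * symCapacity s ≤ symCapacity (r * s) := by
  rcases hr.eq_or_lt with h | h
  · rw [← symCapacity_abs (r * s), abs_mul, ← symCapacity_abs r, h, one_mul, symCapacity_one,
      one_mul, symCapacity_abs]
  rcases hs.eq_or_lt with h' | h'
  · rw [← symCapacity_abs (r * s), abs_mul, ← symCapacity_abs s, h', mul_one, symCapacity_one,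
      mul_one, symCapacity_abs]
  have hrs : |r * s| < 1 := by
    rw [abs_mul]; exact mul_lt_one_of_nonneg_of_lt_one_left (abs_nonneg r) h hs
  set w := symCapacityCoeff
  set x := fun n : ℕ => (r ^ 2) ^ (n + 1)
  set y := fun n : ℕ => (s ^ 2) ^ (n + 1)
  have hr2 : r ^ 2 ≤ 1 := by rw [← sq_abs]; exact pow_le_one₀ (abs_nonneg r) hr
  have hs2 : s ^ 2 ≤ 1 := by rw [← sq_abs]; exact pow_le_one₀ (abs_nonneg s) hs
  have hx : Antitone x := fun m n hmn =>
    pow_le_pow_of_le_one (sq_nonneg r) hr2 (Nat.succ_le_succ hmn)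
  have hy : Antitone y := fun m n hmn =>
    pow_le_pow_of_le_one (sq_nonneg s) hs2 (Nat.succ_le_succ hmn)
  have hw := summable_symCapacityCoeff.hasSum
  have hX : HasSum (fun n => w n * x n) (symCapacity r) := hasSum_symCapacity h
  have hY : HasSum (fun n => w n * y n) (symCapacity s) := hasSum_symCapacity h'
  have hXY : HasSum (fun n => w n * (x n * y n)) (symCapacity (r * s)) := by
    convert hasSum_symCapacity hrs using 2 with n
    simp only [x, y, mul_pow]
    rfl
  have hfin : ∀ N : ℕ, (∑ n ∈ Finset.range N, w n * x n) * (∑ n ∈ Finset.range N, w n * y n)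
      ≤ (∑ n ∈ Finset.range N, w n) * ∑ n ∈ Finset.range N, w n * (x n * y n) := by
    intro N
    -- Both power sequences decrease, so the two differences always have the same sign; expanding
    -- the double sum gives twice the gap sought.
    have h0 : 0 ≤ ∑ m ∈ Finset.range N, ∑ n ∈ Finset.range N,
        w m * w n * ((x m - x n) * (y m - y n)) := by
      refine Finset.sum_nonneg fun m _ => Finset.sum_nonneg fun n _ => mul_nonneg
        (mul_nonneg (symCapacityCoeff_nonneg m) (symCapacityCoeff_nonneg n)) ?_
      rcases le_total m n with hmn | hmn
      · exact mul_nonneg (sub_nonneg.mpr (hx hmn)) (sub_nonneg.mpr (hy hmn))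
      · exact mul_nonneg_of_nonpos_of_nonpos (sub_nonpos.mpr (hx hmn)) (sub_nonpos.mpr (hy hmn))
    have h1 : ∑ m ∈ Finset.range N, ∑ n ∈ Finset.range N,
        w m * w n * ((x m - x n) * (y m - y n))
        = 2 * ((∑ n ∈ Finset.range N, w n) * ∑ n ∈ Finset.range N, w n * (x n * y n))
          - 2 * ((∑ n ∈ Finset.range N, w n * x n) * (∑ n ∈ Finset.range N, w n * y n)) := by
      have e : ∀ m n, w m * w n * ((x m - x n) * (y m - y n))
          = (w m * (x m * y m)) * w n + w m * (w n * (x n * y n))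
            - (w m * x m) * (w n * y n) - (w m * y m) * (w n * x n) := fun m n => by ring
      simp only [e, Finset.sum_add_distrib, Finset.sum_sub_distrib, ← Finset.sum_mul_sum]
      ring
    linarith
  have hlim := le_of_tendsto_of_tendsto'
    (hX.tendsto_sum_nat.mul hY.tendsto_sum_nat)
    (hw.tendsto_sum_nat.mul hXY.tendsto_sum_nat) hfin
  exact hlim.trans (mul_le_of_le_one_left (symCapacity_nonneg hrs.le)
    tsum_symCapacityCoeff_le_one)

/-! ### Entropy contribution of a pair of masses -/

/-- The contribution to `H(A | B)`, in bits, of an outcome `b` of `B` with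
`P(A = 0, B = b) = x` and `P(A = 1, B = b) = y`. -/
def pairEntropy (x y : ℝ) : ℝ :=
  (Real.negMulLog x + Real.negMulLog y - Real.negMulLog (x + y)) / Real.log 2

theorem pairEntropy_comm (x y : ℝ) : pairEntropy x y = pairEntropy y x := by
  rw [pairEntropy, pairEntropy, add_comm (Real.negMulLog x), add_comm x]

theorem pairEntropy_mul (c x y : ℝ) : pairEntropy (c * x) (c * y) = c * pairEntropy x y := by
  simp only [pairEntropy, ← mul_add, Real.negMulLog_mul]
  ring

theorem pairEntropy_half (r : ℝ) :
    pairEntropy ((1 + r) / 2) ((1 - r) / 2) = 1 - symCapacity r := by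
  have hl : Real.log 2 ≠ 0 := (Real.log_pos one_lt_two).ne'
  have e : (1 + r) / 2 + (1 - r) / 2 = 1 := by ring
  have h : ∀ x : ℝ, Real.negMulLog (x / 2) = (x * Real.log 2 - x * Real.log x) / 2 := by
    intro x
    rw [div_eq_mul_inv, Real.negMulLog_mul]
    simp only [Real.negMulLog, Real.log_inv]
    ring
  rw [pairEntropy, e, h, h, Real.negMulLog_one, symCapacity]
  field_simp
  ring

/-- The normalised difference of two masses. -/
def correlation (x y : ℝ) : ℝ := (x - y) / (x + y)

theorem abs_correlation_le_one {x y : ℝ} (hx : 0 ≤ x) (hy : 0 ≤ y) : |correlation x y| ≤ 1 := by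
  rw [correlation, abs_div, abs_of_nonneg (add_nonneg hx hy)]
  refine div_le_one_of_le₀ ?_ (add_nonneg hx hy)
  rw [abs_le]
  constructor <;> linarith

/-- This also covers zero total mass, where the quotient takes the value 0. -/
theorem add_mul_correlation {x y : ℝ} (hx : 0 ≤ x) (hy : 0 ≤ y) :
    (x + y) * correlation x y = x - y := by
  rcases (add_nonneg hx hy).eq_or_lt with h | h
  · have hx0 : x = 0 := by linarith
    have hy0 : y = 0 := by linarith
    simp [hx0, hy0]
  · exact mul_div_cancel₀ _ h.ne'

/-- The total q scales out by homogeneity, leaving a Bernoulli entropy of bias r. -/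
theorem pairEntropy_eq_of_sub {x y q r : ℝ} (hq : x + y = q) (hr : x - y = q * r) :
    pairEntropy x y = q * (1 - symCapacity r) := by
  have hx : x = q * ((1 + r) / 2) := by linarith
  have hy : y = q * ((1 - r) / 2) := by linarith
  rw [hx, hy, pairEntropy_mul, pairEntropy_half]

/-- The chain rule for the two virtual channels of the kernel `T₂`. -/
theorem pairEntropy_chain (a b c d : ℝ) :
    pairEntropy (a * c) (b * d) + pairEntropy (b * c) (a * d) =
      (c + d) * pairEntropy a b + (a + b) * pairEntropy c d
        - pairEntropy (a * c + b * d) (b * c + a * d) := by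
  have e : a * c + b * d + (b * c + a * d) = (a + b) * (c + d) := by ring
  simp only [pairEntropy, e, Real.negMulLog_mul]
  ring

/-! ### Conditional entropy on finite spaces and finite sums -/

section FinProb

variable {Ω α β γ : Type*} [Fintype Ω]

theorem finProb_nonneg {μ : Ω → ℝ} (hμ : ∀ ω, 0 ≤ μ ω) (A : Ω → α) (a : α) :
    0 ≤ finProb μ A a :=
  Finset.sum_nonneg fun ω _ => by split_ifs <;> simp [hμ]

theorem sum_finProb_pair [Fintype α] (μ : Ω → ℝ) (A : Ω → α) (B : Ω → β) (b : β) :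
    ∑ a, finProb μ (fun ω => (A ω, B ω)) (a, b) = finProb μ B b := by
  classical
  unfold finProb
  rw [Finset.sum_comm]
  refine Finset.sum_congr rfl fun ω _ => ?_
  by_cases h : B ω = b <;> simp [h]

theorem condEntropy_eq_sum_pairEntropy [Fintype β] {μ : Ω → ℝ} (hμ : ∀ ω, 0 ≤ μ ω)
    (A : Ω → ZMod 2) (B : Ω → β) :
    condEntropy μ A B = ∑ b, pairEntropy (finProb μ (fun ω => (A ω, B ω)) (0, b))
      (finProb μ (fun ω => (A ω, B ω)) (1, b)) := by
  have key : ∀ x y : ℝ, 0 ≤ x → 0 ≤ y →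
      x * Real.logb 2 (x / (x + y)) + y * Real.logb 2 (y / (x + y)) = - pairEntropy x y := by
    intro x y hx hy
    have h : ∀ z : ℝ, 0 ≤ z → z ≤ x + y →
        z * Real.logb 2 (z / (x + y)) = z * (Real.log z - Real.log (x + y)) / Real.log 2 := by
      intro z hz hzs
      rcases hz.eq_or_lt with rfl | hz
      · simp
      · rw [Real.logb, Real.log_div hz.ne' (by linarith)]
        ring
    rw [h x hx (by linarith), h y hy (by linarith)]
    simp only [pairEntropy, Real.negMulLog]
    ring
  rw [condEntropy, Finset.sum_comm, ← Finset.sum_neg_distrib]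
  refine Finset.sum_congr rfl fun b _ => ?_
  rw [← sum_finProb_pair μ A B b]
  have e : ∀ f : ZMod 2 → ℝ, ∑ a, f a = f 0 + f 1 := fun f => Fin.sum_univ_two f
  rw [e, e, key _ _ (finProb_nonneg hμ _ _) (finProb_nonneg hμ _ _), neg_neg]

theorem finProb_equiv (μ : Ω → ℝ) (B : Ω → β) (e : β ≃ γ) (b : β) :
    finProb μ (fun ω => e (B ω)) (e b) = finProb μ B b := by
  unfold finProb
  refine Finset.sum_congr rfl fun ω _ => ?_
  by_cases h : B ω = b <;> simp [h]

theorem condEntropy_equiv [Fintype α] [Fintype β] [Fintype γ] (μ : Ω → ℝ) (A : Ω → α) (B : Ω → β) (e : β ≃ γ) :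
    condEntropy μ A (fun ω => e (B ω)) = condEntropy μ A B := by
  have h : ∀ a b, finProb μ (fun ω => (A ω, e (B ω))) (a, e b)
      = finProb μ (fun ω => (A ω, B ω)) (a, b) := fun a b =>
    finProb_equiv μ (fun ω => (A ω, B ω)) ((Equiv.refl α).prodCongr e) (a, b)
  simp only [condEntropy]
  congr 1
  refine Finset.sum_congr rfl fun a _ => ?_
  rw [← e.sum_comp]
  simp only [h, finProb_equiv]

end FinProb

theorem sum_zmod_two {M : Type*} [AddCommMonoid M] (f : ZMod 2 → M) : ∑ a, f a = f 0 + f 1 :=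
  Fin.sum_univ_two f

theorem sum_fin_two_fun {α M : Type*} [Fintype α] [AddCommMonoid M] (f : (Fin 2 → α) → M) :
    ∑ v, f v = ∑ a, ∑ b, f ![a, b] := by
  rw [← (finTwoArrowEquiv α).symm.sum_comp, Fintype.sum_prod_type]
  rfl

theorem sum_fin_three_fun {α M : Type*} [Fintype α] [AddCommMonoid M] (f : (Fin 3 → α) → M) :
    ∑ v, f v = ∑ a, ∑ b, ∑ c, f ![a, b, c] := by
  rw [← (Fin.consEquiv fun _ : Fin 3 => α).sum_comp, Fintype.sum_prod_type]
  refine Finset.sum_congr rfl fun a _ => ?_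
  rw [sum_fin_two_fun]
  rfl

/-! ### Channels as mixtures of binary symmetric channels -/

namespace BinChannel

theorem jointLaw_nonneg (W : BinChannel.{u}) (ω) : 0 ≤ W.jointLaw ω :=
  mul_nonneg (by norm_num) (W.prob_nonneg _ _)

theorem vectorLaw_nonneg (W : BinChannel.{u}) {l : ℕ} (T : BinKernel l) (ω) :
    0 ≤ W.vectorLaw T ω :=
  mul_nonneg (by positivity) (Finset.prod_nonneg fun _ _ => W.prob_nonneg _ _)

/-- The joint probability `P(X = x, Y = y)`. -/
def mass (W : BinChannel.{u}) (x : ZMod 2) (y : W.Out) : ℝ := 1 / 2 * W.prob x y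

theorem mass_nonneg (W : BinChannel.{u}) (x : ZMod 2) (y : W.Out) : 0 ≤ W.mass x y :=
  mul_nonneg (by norm_num) (W.prob_nonneg _ _)

/-- The output probability `P(Y = y)`. -/
def outMass (W : BinChannel.{u}) (y : W.Out) : ℝ := W.mass 0 y + W.mass 1 y

theorem outMass_nonneg (W : BinChannel.{u}) (y : W.Out) : 0 ≤ W.outMass y :=
  add_nonneg (W.mass_nonneg _ _) (W.mass_nonneg _ _)

theorem sum_outMass (W : BinChannel.{u}) : ∑ y, W.outMass y = 1 := by
  simp only [outMass, mass, Finset.sum_add_distrib, ← Finset.mul_sum, W.sum_prob]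
  norm_num

/-- The bias `P(X = 0 | Y = y) - P(X = 1 | Y = y)`. -/
def bias (W : BinChannel.{u}) (y : W.Out) : ℝ := correlation (W.mass 0 y) (W.mass 1 y)

theorem abs_bias_le_one (W : BinChannel.{u}) (y : W.Out) : |W.bias y| ≤ 1 :=
  abs_correlation_le_one (W.mass_nonneg _ _) (W.mass_nonneg _ _)

theorem mass_sub (W : BinChannel.{u}) (y : W.Out) :
    W.mass 0 y - W.mass 1 y = W.outMass y * W.bias y :=
  (add_mul_correlation (W.mass_nonneg _ _) (W.mass_nonneg _ _)).symm

theorem finProb_jointLaw (W : BinChannel.{u}) (x : ZMod 2) (y : W.Out) :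
    finProb W.jointLaw (fun ω => (ω.1, ω.2)) (x, y) = W.mass x y := by
  rw [finProb, Finset.sum_eq_single (x, y)]
  · simp [jointLaw, mass]
  · intro ω _ hω
    exact if_neg hω
  · simp

theorem inputEntropy_eq_sum_pairEntropy (W : BinChannel.{u}) :
    W.inputEntropy = ∑ y, pairEntropy (W.mass 0 y) (W.mass 1 y) := by
  rw [inputEntropy, condEntropy_eq_sum_pairEntropy W.jointLaw_nonneg]
  simp only [finProb_jointLaw]

theorem info_eq_one_sub_inputEntropy (W : BinChannel.{u}) : W.info = 1 - W.inputEntropy := by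
  have hfst : ∀ x, finProb W.jointLaw Prod.fst x = 1 / 2 := by
    intro x
    have h : finProb W.jointLaw Prod.fst x = ∑ y, W.mass x y := by
      rw [finProb, Fintype.sum_prod_type, Finset.sum_comm]
      refine Finset.sum_congr rfl fun y _ => ?_
      rw [Finset.sum_eq_single x]
      · simp [jointLaw, mass]
      · intro x' _ hx
        exact if_neg hx
      · simp
    rw [h]
    simp only [mass, ← Finset.mul_sum, W.sum_prob, mul_one]
  have hsnd : ∀ y, finProb W.jointLaw Prod.snd y = W.outMass y := by
    intro y
    rw [← sum_finProb_pair W.jointLaw Prod.fst Prod.snd, sum_zmod_two]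
    simp only [finProb_jointLaw, outMass]
  have hterm : ∀ x y, W.mass x y * Real.logb 2 (W.mass x y / (1 / 2 * W.outMass y))
      = W.mass x y + W.mass x y * Real.logb 2 (W.mass x y / W.outMass y) := by
    intro x y
    rcases (W.mass_nonneg x y).eq_or_lt with h | h
    · simp [← h]
    · have hle : W.mass x y ≤ W.outMass y := by
        have h0 := W.mass_nonneg 0 y
        have h1 := W.mass_nonneg 1 y
        unfold outMass
        rcases (by decide : ∀ x : ZMod 2, x = 0 ∨ x = 1) x with rfl | rfl <;> linarith
      have hq : 0 < W.outMass y := h.trans_le hle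
      have e : W.mass x y / (1 / 2 * W.outMass y) = 2 * (W.mass x y / W.outMass y) := by
        field_simp
      rw [e, Real.logb_mul two_ne_zero (div_pos h hq).ne', Real.logb_self_eq_one one_lt_two]
      ring
  have hsum : ∑ x, ∑ y, W.mass x y = 1 := by
    rw [Finset.sum_comm, ← W.sum_outMass]
    simp only [sum_zmod_two, outMass]
  simp only [info, mutualInfo, inputEntropy, condEntropy, finProb_jointLaw, hfst, hsnd, hterm,
    Finset.sum_add_distrib, hsum]
  ring

theorem info_eq_sum_symCapacity (W : BinChannel.{u}) :
    W.info = ∑ y, W.outMass y * symCapacity (W.bias y) := by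
  rw [info_eq_one_sub_inputEntropy, inputEntropy_eq_sum_pairEntropy]
  have h : ∀ y, pairEntropy (W.mass 0 y) (W.mass 1 y)
      = W.outMass y - W.outMass y * symCapacity (W.bias y) := by
    intro y
    rw [pairEntropy_eq_of_sub rfl (W.mass_sub y)]
    unfold outMass
    ring
  simp only [h, Finset.sum_sub_distrib, W.sum_outMass]
  ring

/-- The weight 2⁻ˡ is spread over the l factors, turning each transition probability into a joint
mass. -/
theorem condEntropy_vectorLaw (W : BinChannel.{u}) {l : ℕ} (T : BinKernel l) {β : Type*}
    [Fintype β] [DecidableEq β] (f : (Fin l → ZMod 2) → ZMod 2) (g : (Fin l → ZMod 2) → β) :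
    condEntropy (W.vectorLaw T) (fun ω => f ω.1) (fun ω => (ω.2, g ω.1)) =
      ∑ y : Fin l → W.Out, ∑ c, pairEntropy
        (∑ u, if f u = 0 ∧ g u = c then ∏ j, W.mass (Matrix.vecMul u T j) (y j) else 0)
        (∑ u, if f u = 1 ∧ g u = c then ∏ j, W.mass (Matrix.vecMul u T j) (y j) else 0) := by
  have h : ∀ a y c, finProb (W.vectorLaw T) (fun ω => (f ω.1, (ω.2, g ω.1))) (a, (y, c))
      = ∑ u, if f u = a ∧ g u = c then ∏ j, W.mass (Matrix.vecMul u T j) (y j) else 0 := by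
    intro a y c
    classical
    simp only [finProb, Fintype.sum_prod_type]
    refine Finset.sum_congr rfl fun u _ => ?_
    rw [Finset.sum_eq_single y]
    · simp [vectorLaw, mass, Finset.prod_mul_distrib]
    · intro z _ hz
      simp [hz]
    · simp
  rw [condEntropy_eq_sum_pairEntropy (W.vectorLaw_nonneg T), Fintype.sum_prod_type]
  simp only [h]

theorem inputEntropy_sub (W : BinChannel.{u}) {l : ℕ} (T : BinKernel l) (i : Fin l) :
    (W.sub T i).inputEntropy = condEntropy (W.vectorLaw T) (fun ω => ω.1 i)
      (fun ω => (ω.2, fun j : {j : Fin l // j < i} => ω.1 j)) := by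
  have hm : ∀ a z, (W.sub T i).mass a z = ∑ u, if u i = a ∧
      (fun j : {j : Fin l // j < i} => u j) = z.2 then
      ∏ j, W.mass (Matrix.vecMul u T j) (z.1 j) else 0 := by
    intro a z
    have hl : (1 / 2 : ℝ) * (1 / 2) ^ (l - 1) = (1 / 2) ^ l := by
      rw [← pow_succ', Nat.sub_add_cancel i.pos]
    simp only [mass, sub, subProb, Finset.mul_sum, Finset.prod_mul_distrib, Finset.prod_const,
      Finset.card_univ, Fintype.card_fin, mul_ite, mul_zero, ← mul_assoc, hl]
  rw [inputEntropy_eq_sum_pairEntropy, condEntropy_vectorLaw W T (fun u => u i)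
    (fun u (j : {j : Fin l // j < i}) => u j)]
  simp only [hm]
  exact Fintype.sum_prod_type _

/-- Relabelling the past bits leaves the entropy unchanged; this replaces functions on a subtype by
concrete tuples. -/
theorem inputEntropy_sub_eq (W : BinChannel.{u}) {l : ℕ} (T : BinKernel l) (i : Fin l)
    {β : Type*} [Fintype β] (e : ({j : Fin l // j < i} → ZMod 2) ≃ β) :
    (W.sub T i).inputEntropy = condEntropy (W.vectorLaw T) (fun ω => ω.1 i)
      (fun ω => (ω.2, e fun j : {j : Fin l // j < i} => ω.1 j)) := by
  rw [inputEntropy_sub]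
  let E : (Fin l → W.Out) × ({j : Fin l // j < i} → ZMod 2) ≃ (Fin l → W.Out) × β :=
    (Equiv.refl _).prodCongr e
  exact (condEntropy_equiv (W.vectorLaw T) (fun ω => ω.1 i)
    (fun ω => (ω.2, fun j : {j : Fin l // j < i} => ω.1 j)) E).symm

end BinChannel

/-! ### Inequalities between the information quantities -/

namespace BinChannel

/-- The information about `X₁ + X₂` carried by the outputs of two uses of `W`. -/
def xorInfo (W : BinChannel.{u}) : ℝ :=
  ∑ y, ∑ z, W.outMass y * W.outMass z * symCapacity (W.bias y * W.bias z)

/-- The information about `X₁ + X₂ + X₃` carried by the outputs of three uses of `W`. -/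
def tripleXorInfo (W : BinChannel.{u}) : ℝ :=
  ∑ x, ∑ y, ∑ z, W.outMass x * W.outMass y * W.outMass z *
    symCapacity (W.bias x * (W.bias y * W.bias z))

/-- The second moment of the bias. -/
def biasSq (W : BinChannel.{u}) : ℝ := ∑ y, W.outMass y * W.bias y ^ 2

theorem info_nonneg (W : BinChannel.{u}) : 0 ≤ W.info := by
  rw [info_eq_sum_symCapacity]
  exact Finset.sum_nonneg fun y _ =>
    mul_nonneg (W.outMass_nonneg y) (symCapacity_nonneg (W.abs_bias_le_one y))

theorem info_le_one (W : BinChannel.{u}) : W.info ≤ 1 := by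
  rw [info_eq_sum_symCapacity, ← W.sum_outMass]
  exact Finset.sum_le_sum fun y _ =>
    mul_le_of_le_one_right (W.outMass_nonneg y) (symCapacity_le_one (W.abs_bias_le_one y))

/-- Jensen for the square, applied to the average of 1 - C(r), followed by the pointwise bound (1 -
C(r))² ≤ 1 - r². -/
theorem biasSq_le (W : BinChannel.{u}) : W.biasSq ≤ 1 - (1 - W.info) ^ 2 := by
  have h1 : 1 - W.info = ∑ y, W.outMass y * (1 - symCapacity (W.bias y)) := by
    simp only [mul_sub, mul_one, Finset.sum_sub_distrib, W.sum_outMass, ← info_eq_sum_symCapacity]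
  have h2 : (1 - W.info) ^ 2 ≤ ∑ y, W.outMass y * (1 - symCapacity (W.bias y)) ^ 2 := by
    rw [h1]
    exact even_two.convexOn_pow.map_sum_le (fun y _ => W.outMass_nonneg y) W.sum_outMass
      fun _ _ => Set.mem_univ _
  have h3 : ∑ y, W.outMass y * (1 - symCapacity (W.bias y)) ^ 2
      ≤ ∑ y, W.outMass y * (1 - W.bias y ^ 2) :=
    Finset.sum_le_sum fun y _ => mul_le_mul_of_nonneg_left
      (one_sub_symCapacity_sq_le (W.abs_bias_le_one y)) (W.outMass_nonneg y)
  have h4 : ∑ y, W.outMass y * (1 - W.bias y ^ 2) = 1 - W.biasSq := by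
    simp only [mul_sub, mul_one, Finset.sum_sub_distrib, W.sum_outMass, biasSq]
  linarith

theorem xorInfo_le (W : BinChannel.{u}) : W.xorInfo ≤ W.biasSq * W.info := by
  rw [info_eq_sum_symCapacity, biasSq, Finset.sum_mul_sum]
  refine Finset.sum_le_sum fun y _ => Finset.sum_le_sum fun z _ => ?_
  have := mul_le_mul_of_nonneg_left
    (symCapacity_mul_le (W.abs_bias_le_one y) (W.abs_bias_le_one z))
    (mul_nonneg (W.outMass_nonneg y) (W.outMass_nonneg z))
  linarith

theorem info_sq_le_xorInfo (W : BinChannel.{u}) : W.info ^ 2 ≤ W.xorInfo := by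
  rw [sq, info_eq_sum_symCapacity, Finset.sum_mul_sum]
  refine Finset.sum_le_sum fun y _ => Finset.sum_le_sum fun z _ => ?_
  have := mul_le_mul_of_nonneg_left
    (symCapacity_mul_symCapacity_le (W.abs_bias_le_one y) (W.abs_bias_le_one z))
    (mul_nonneg (W.outMass_nonneg y) (W.outMass_nonneg z))
  linarith

theorem tripleXorInfo_le (W : BinChannel.{u}) : W.tripleXorInfo ≤ W.biasSq * W.xorInfo := by
  have h : W.biasSq * W.xorInfo = ∑ x, ∑ y, ∑ z, W.outMass x * W.bias x ^ 2 *
      (W.outMass y * W.outMass z * symCapacity (W.bias y * W.bias z)) := by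
    simp only [biasSq, xorInfo, Finset.sum_mul, ← Finset.mul_sum]
  rw [h]
  refine Finset.sum_le_sum fun x _ => Finset.sum_le_sum fun y _ => Finset.sum_le_sum fun z _ => ?_
  have := mul_le_mul_of_nonneg_left
    (symCapacity_mul_le (W.abs_bias_le_one x)
      (abs_mul_le_one (W.abs_bias_le_one y) (W.abs_bias_le_one z)))
    (mul_nonneg (mul_nonneg (W.outMass_nonneg x) (W.outMass_nonneg y)) (W.outMass_nonneg z))
  linarith

theorem xorInfo_le_info_sub (W : BinChannel.{u}) :
    W.xorInfo ≤ W.info - W.info * (1 - W.info) ^ 2 := by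
  have := mul_le_mul_of_nonneg_right W.biasSq_le W.info_nonneg
  linarith [W.xorInfo_le]

theorem tripleXorInfo_le_xorInfo_sub (W : BinChannel.{u}) :
    W.tripleXorInfo ≤ W.xorInfo - W.info ^ 2 * (1 - W.info) ^ 2 := by
  have h0 : 0 ≤ W.xorInfo := (sq_nonneg _).trans W.info_sq_le_xorInfo
  have h1 := mul_le_mul_of_nonneg_right W.biasSq_le h0
  have h2 := mul_le_mul_of_nonneg_right W.info_sq_le_xorInfo (sq_nonneg (1 - W.info))
  linarith [W.tripleXorInfo_le]

theorem info_sq_mul_le (W : BinChannel.{u}) :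
    W.info ^ 2 * (1 - W.info) ^ 2 ≤ W.info * (1 - W.info) ^ 2 := by
  refine mul_le_mul_of_nonneg_right ?_ (sq_nonneg _)
  rw [sq]
  exact mul_le_of_le_one_left W.info_nonneg W.info_le_one

/-! ### Entropies of sums of inputs and chain rules -/

theorem pairEntropy_xor (W : BinChannel.{u}) (y z : W.Out) :
    pairEntropy (W.mass 0 y * W.mass 0 z + W.mass 1 y * W.mass 1 z)
      (W.mass 1 y * W.mass 0 z + W.mass 0 y * W.mass 1 z)
      = W.outMass y * W.outMass z * (1 - symCapacity (W.bias y * W.bias z)) := by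
  refine pairEntropy_eq_of_sub ?_ ?_
  · unfold outMass
    ring
  -- The even mass minus the odd mass is the product of the two mass differences: biases multiply.
  · linear_combination W.mass_sub y * (W.mass 0 z - W.mass 1 z)
      + W.outMass y * W.bias y * W.mass_sub z

theorem sum_pairEntropy_xor (W : BinChannel.{u}) :
    ∑ y, ∑ z, pairEntropy (W.mass 0 y * W.mass 0 z + W.mass 1 y * W.mass 1 z)
      (W.mass 1 y * W.mass 0 z + W.mass 0 y * W.mass 1 z) = 1 - W.xorInfo := by
  simp only [pairEntropy_xor, mul_sub, mul_one, Finset.sum_sub_distrib, ← Finset.mul_sum,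
    W.sum_outMass, xorInfo]

/-- Chain rule for two uses of `W`. -/
theorem sum_pairEntropy_repeat (W : BinChannel.{u}) :
    ∑ y, ∑ z, (pairEntropy (W.mass 0 y * W.mass 0 z) (W.mass 1 y * W.mass 1 z) +
      pairEntropy (W.mass 1 y * W.mass 0 z) (W.mass 0 y * W.mass 1 z))
      = 2 * W.inputEntropy - (1 - W.xorInfo) := by
  have h : ∀ y, W.mass 0 y + W.mass 1 y = W.outMass y := fun _ => rfl
  simp only [pairEntropy_chain, h, Finset.sum_sub_distrib, Finset.sum_add_distrib,
    sum_pairEntropy_xor, ← Finset.mul_sum, ← Finset.sum_mul, W.sum_outMass,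
    ← inputEntropy_eq_sum_pairEntropy]
  ring

theorem pairEntropy_triple_xor (W : BinChannel.{u}) (x y z : W.Out) :
    pairEntropy
      (W.mass 0 x * (W.mass 0 y * W.mass 0 z + W.mass 1 y * W.mass 1 z)
        + W.mass 1 x * (W.mass 1 y * W.mass 0 z + W.mass 0 y * W.mass 1 z))
      (W.mass 1 x * (W.mass 0 y * W.mass 0 z + W.mass 1 y * W.mass 1 z)
        + W.mass 0 x * (W.mass 1 y * W.mass 0 z + W.mass 0 y * W.mass 1 z))
      = W.outMass x * W.outMass y * W.outMass z *
        (1 - symCapacity (W.bias x * (W.bias y * W.bias z))) := by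
  refine pairEntropy_eq_of_sub ?_ ?_
  · unfold outMass
    ring
  · linear_combination W.mass_sub x * ((W.mass 0 y - W.mass 1 y) * (W.mass 0 z - W.mass 1 z))
      + W.outMass x * W.bias x * (W.mass_sub y * (W.mass 0 z - W.mass 1 z)
      + W.outMass y * W.bias y * W.mass_sub z)

theorem sum_pairEntropy_triple_xor (W : BinChannel.{u}) :
    ∑ x, ∑ y, ∑ z, pairEntropy
      (W.mass 0 x * (W.mass 0 y * W.mass 0 z + W.mass 1 y * W.mass 1 z)
        + W.mass 1 x * (W.mass 1 y * W.mass 0 z + W.mass 0 y * W.mass 1 z))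
      (W.mass 1 x * (W.mass 0 y * W.mass 0 z + W.mass 1 y * W.mass 1 z)
        + W.mass 0 x * (W.mass 1 y * W.mass 0 z + W.mass 0 y * W.mass 1 z))
      = 1 - W.tripleXorInfo := by
  simp only [pairEntropy_triple_xor, mul_sub, mul_one, Finset.sum_sub_distrib, ← Finset.mul_sum,
    W.sum_outMass, tripleXorInfo]

/-- With V = X₂ + X₃ independent of X₁, this is the chain rule H(V | Y, X₁ + V) = H(X₁ | Y) + H(V |
Y) - H(X₁ + V | Y). -/
theorem sum_pairEntropy_mixed (W : BinChannel.{u}) :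
    ∑ x, ∑ y, ∑ z, (pairEntropy
      (W.mass 0 x * (W.mass 0 y * W.mass 0 z + W.mass 1 y * W.mass 1 z))
      (W.mass 1 x * (W.mass 1 y * W.mass 0 z + W.mass 0 y * W.mass 1 z))
      + pairEntropy
      (W.mass 1 x * (W.mass 0 y * W.mass 0 z + W.mass 1 y * W.mass 1 z))
      (W.mass 0 x * (W.mass 1 y * W.mass 0 z + W.mass 0 y * W.mass 1 z)))
      = W.inputEntropy + W.tripleXorInfo - W.xorInfo := by
  have h : ∀ y z, W.mass 0 y * W.mass 0 z + W.mass 1 y * W.mass 1 z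
      + (W.mass 1 y * W.mass 0 z + W.mass 0 y * W.mass 1 z) = W.outMass y * W.outMass z := by
    intro y z
    unfold outMass
    ring
  have h' : ∀ y, W.mass 0 y + W.mass 1 y = W.outMass y := fun _ => rfl
  simp only [pairEntropy_chain, h, h', Finset.sum_sub_distrib, Finset.sum_add_distrib,
    sum_pairEntropy_triple_xor, ← Finset.mul_sum, ← Finset.sum_mul, W.sum_outMass,
    sum_pairEntropy_xor, ← inputEntropy_eq_sum_pairEntropy]
  ring

/-! ### The virtual channels of the two kernels -/

theorem condEntropy_kernelT2_zero (W : BinChannel.{u}) :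
    condEntropy (W.vectorLaw kernelT2) (fun ω => ω.1 0) (fun ω => (ω.2, ())) = 1 - W.xorInfo := by
  rw [condEntropy_vectorLaw W kernelT2 (fun u => u 0) (fun _ => ()), sum_fin_two_fun,
    ← sum_pairEntropy_xor]
  refine Finset.sum_congr rfl fun y _ => Finset.sum_congr rfl fun z _ => ?_
  have h : (1 : ZMod 2) + 1 = 0 := rfl
  simp [sum_fin_two_fun, sum_zmod_two, kernelT2, Matrix.vecMul, dotProduct, Fin.sum_univ_two,
    Fin.prod_univ_two, h]

theorem condEntropy_kernelT2_one (W : BinChannel.{u}) :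
    condEntropy (W.vectorLaw kernelT2) (fun ω => ω.1 1) (fun ω => (ω.2, ω.1 0))
      = 2 * W.inputEntropy - (1 - W.xorInfo) := by
  rw [condEntropy_vectorLaw W kernelT2 (fun u => u 1) (fun u => u 0), sum_fin_two_fun,
    ← sum_pairEntropy_repeat]
  refine Finset.sum_congr rfl fun y _ => Finset.sum_congr rfl fun z _ => ?_
  have h : (1 : ZMod 2) + 1 = 0 := rfl
  simp [sum_fin_two_fun, sum_zmod_two, kernelT2, Matrix.vecMul, dotProduct, Fin.sum_univ_two,
    Fin.prod_univ_two, h]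

theorem condEntropy_kernelT3_zero (W : BinChannel.{u}) :
    condEntropy (W.vectorLaw kernelT3) (fun ω => ω.1 0) (fun ω => (ω.2, ()))
      = 1 - W.tripleXorInfo := by
  rw [condEntropy_vectorLaw W kernelT3 (fun u => u 0) (fun _ => ()), sum_fin_three_fun,
    ← sum_pairEntropy_triple_xor]
  refine Finset.sum_congr rfl fun x _ => Finset.sum_congr rfl fun y _ =>
    Finset.sum_congr rfl fun z _ => ?_
  have h : (1 : ZMod 2) + 1 = 0 := rfl
  simp [sum_fin_three_fun, sum_zmod_two, kernelT3, Matrix.vecMul, dotProduct, Fin.sum_univ_three,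
    Fin.prod_univ_three, h]
  congr 1 <;> ring

theorem condEntropy_kernelT3_one (W : BinChannel.{u}) :
    condEntropy (W.vectorLaw kernelT3) (fun ω => ω.1 1) (fun ω => (ω.2, ω.1 0))
      = W.inputEntropy + W.tripleXorInfo - W.xorInfo := by
  rw [condEntropy_vectorLaw W kernelT3 (fun u => u 1) (fun u => u 0), sum_fin_three_fun,
    ← sum_pairEntropy_mixed]
  refine Finset.sum_congr rfl fun x _ => Finset.sum_congr rfl fun y _ =>
    Finset.sum_congr rfl fun z _ => ?_
  have h : (1 : ZMod 2) + 1 = 0 := rfl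
  simp [sum_fin_three_fun, sum_zmod_two, kernelT3, Matrix.vecMul, dotProduct, Fin.sum_univ_three,
    Fin.prod_univ_three, h]
  congr 2 <;> ring

/-- Once U₁ and U₂ are known, so is X₁, while X₂ and X₃ are known shifts of U₃: the first output is
useless and U₃ is sent twice, as for the second bit of `kernelT2`. -/
theorem condEntropy_kernelT3_two (W : BinChannel.{u}) :
    condEntropy (W.vectorLaw kernelT3) (fun ω => ω.1 2) (fun ω => (ω.2, (ω.1 0, ω.1 1)))
      = 2 * W.inputEntropy - (1 - W.xorInfo) := by
  have hsum : ∀ F : W.Out → W.Out → ℝ, ∑ x, ∑ y, ∑ z, W.outMass x * F y z = ∑ y, ∑ z, F y z := by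
    intro F
    simp only [← Finset.mul_sum, ← Finset.sum_mul, W.sum_outMass, one_mul]
  rw [condEntropy_vectorLaw W kernelT3 (fun u => u 2) (fun u => (u 0, u 1)), sum_fin_three_fun,
    ← sum_pairEntropy_repeat,
    ← hsum fun y z => pairEntropy (W.mass 0 y * W.mass 0 z) (W.mass 1 y * W.mass 1 z) +
      pairEntropy (W.mass 1 y * W.mass 0 z) (W.mass 0 y * W.mass 1 z)]
  refine Finset.sum_congr rfl fun x _ => Finset.sum_congr rfl fun y _ =>
    Finset.sum_congr rfl fun z _ => ?_
  have h : (1 : ZMod 2) + 1 = 0 := rfl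
  simp [Fintype.sum_prod_type, sum_fin_three_fun, sum_zmod_two, kernelT3, Matrix.vecMul,
    dotProduct, Fin.sum_univ_three, Fin.prod_univ_three, h, mul_assoc, pairEntropy_mul, outMass]
  -- X₂ = U₁ + U₃, so U₁ = 1 exchanges the roles of the two values of U₃.
  rw [pairEntropy_comm (W.mass 1 y * W.mass 1 z), pairEntropy_comm (W.mass 0 y * W.mass 1 z)]
  ring

theorem info_sub (W : BinChannel.{u}) {l : ℕ} (T : BinKernel l) (i : Fin l)
    {β : Type*} [Fintype β] (e : ({j : Fin l // j < i} → ZMod 2) ≃ β) :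
    (W.sub T i).info = 1 - condEntropy (W.vectorLaw T) (fun ω => ω.1 i)
      (fun ω => (ω.2, e fun j : {j : Fin l // j < i} => ω.1 j)) := by
  rw [info_eq_one_sub_inputEntropy, inputEntropy_sub_eq W T i e]

/-- There is no bit before the first one. -/
def pastZeroEquiv (l : ℕ) : ({j : Fin (l + 1) // j < 0} → ZMod 2) ≃ Unit :=
  haveI : IsEmpty {j : Fin (l + 1) // j < 0} := ⟨fun j => Fin.not_lt_zero _ j.2⟩
  Equiv.ofUnique _ _

/-- The past of the second bit is the first one. -/
def pastOneEquiv (l : ℕ) : ({j : Fin (l + 2) // j < 1} → ZMod 2) ≃ ZMod 2 where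
  toFun v := v ⟨0, Fin.zero_lt_one⟩
  invFun a _ := a
  left_inv v := by
    funext ⟨j, hj⟩
    have : j = 0 := Fin.lt_one_iff j |>.mp hj
    subst this
    rfl
  right_inv _ := rfl

/-- The past of the third bit of three consists of the first two. -/
def pastTwoEquiv : ({j : Fin 3 // j < 2} → ZMod 2) ≃ ZMod 2 × ZMod 2 where
  toFun v := (v ⟨0, by decide⟩, v ⟨1, by decide⟩)
  invFun p j := if j.1 = 0 then p.1 else p.2
  left_inv v := by
    funext ⟨j, hj⟩
    fin_cases j
    · rfl
    · rfl
    · exact absurd hj (by decide)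
  right_inv _ := rfl

theorem info_sub_kernelT2_zero (W : BinChannel.{u}) : (W.sub kernelT2 0).info = W.xorInfo := by
  rw [info_sub W kernelT2 0 (pastZeroEquiv 1)]
  linarith [W.condEntropy_kernelT2_zero]

theorem info_sub_kernelT2_one (W : BinChannel.{u}) :
    (W.sub kernelT2 1).info = 2 * W.info - W.xorInfo := by
  have h := W.condEntropy_kernelT2_one
  rw [info_sub W kernelT2 1 (pastOneEquiv 0), info_eq_one_sub_inputEntropy]
  simp only [pastOneEquiv, Equiv.coe_fn_mk]
  linarith

theorem info_sub_kernelT3_zero (W : BinChannel.{u}) :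
    (W.sub kernelT3 0).info = W.tripleXorInfo := by
  rw [info_sub W kernelT3 0 (pastZeroEquiv 2)]
  linarith [W.condEntropy_kernelT3_zero]

theorem info_sub_kernelT3_one (W : BinChannel.{u}) :
    (W.sub kernelT3 1).info = W.info + W.xorInfo - W.tripleXorInfo := by
  have h := W.condEntropy_kernelT3_one
  rw [info_sub W kernelT3 1 (pastOneEquiv 1), info_eq_one_sub_inputEntropy]
  simp only [pastOneEquiv, Equiv.coe_fn_mk]
  linarith

theorem info_sub_kernelT3_two (W : BinChannel.{u}) :
    (W.sub kernelT3 2).info = 2 * W.info - W.xorInfo := by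
  have h := W.condEntropy_kernelT3_two
  rw [info_sub W kernelT3 2 pastTwoEquiv, info_eq_one_sub_inputEntropy]
  simp only [pastTwoEquiv, Equiv.coe_fn_mk]
  linarith

theorem condEntropy_snd (W : BinChannel.{u}) {l : ℕ} (T : BinKernel l)
    (A : (Fin l → ZMod 2) × (Fin l → W.Out) → ZMod 2) :
    condEntropy (W.vectorLaw T) A Prod.snd
      = condEntropy (W.vectorLaw T) A (fun ω => (ω.2, ())) :=
  (condEntropy_equiv (W.vectorLaw T) A Prod.snd (Equiv.prodPUnit (Fin l → W.Out)).symm).symm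

end BinChannel

/-! ### Kernel bits as sums of inputs, and the final inequalities -/

theorem chanInput_kernelT2_add {Y : Type*} (ω : (Fin 2 → ZMod 2) × (Fin 2 → Y)) :
    chanInput kernelT2 0 ω + chanInput kernelT2 1 ω = ω.1 0 := by
  have h : ∀ v : Fin 2 → ZMod 2,
      Matrix.vecMul v kernelT2 0 + Matrix.vecMul v kernelT2 1 = v 0 := by decide
  exact h ω.1

theorem chanInput_kernelT3_add {Y : Type*} (ω : (Fin 3 → ZMod 2) × (Fin 3 → Y)) :
    chanInput kernelT3 0 ω + chanInput kernelT3 1 ω + chanInput kernelT3 2 ω = ω.1 0 := by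
  have h : ∀ v : Fin 3 → ZMod 2, Matrix.vecMul v kernelT3 0 + Matrix.vecMul v kernelT3 1
      + Matrix.vecMul v kernelT3 2 = v 0 := by decide
  exact h ω.1

theorem chanInput_kernelT3_one_add_two {Y : Type*} (ω : (Fin 3 → ZMod 2) × (Fin 3 → Y)) :
    chanInput kernelT3 1 ω + chanInput kernelT3 2 ω = ω.1 1 := by
  have h : ∀ v : Fin 3 → ZMod 2,
      Matrix.vecMul v kernelT3 1 + Matrix.vecMul v kernelT3 2 = v 1 := by decide
  exact h ω.1

theorem polarizationInequality_kernelT2 : PolarizationInequality.{u} kernelT2 1 2 := by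
  intro W past b
  generalize W.descend past = V
  have h := V.xorInfo_le_info_sub
  rw [Real.rpow_one, Real.rpow_two, ge_iff_le]
  rcases (by decide : ∀ b : Fin 2, b = 0 ∨ b = 1) b with rfl | rfl
  -- The first virtual channel loses information, the other gains it; this fixes the sign in the
  -- absolute value.
  · refine le_trans ?_ (neg_le_abs _)
    rw [V.info_sub_kernelT2_zero]
    linarith
  · refine le_trans ?_ (le_abs_self _)
    rw [V.info_sub_kernelT2_one]
    linarith

theorem polarizationInequality_kernelT3 : PolarizationInequality.{u} kernelT3 2 2 := by
  intro W past b
  generalize W.descend past = V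
  have h := V.xorInfo_le_info_sub
  have h' := V.tripleXorInfo_le_xorInfo_sub
  have h'' := V.info_sq_mul_le
  have h0 : 0 ≤ V.info ^ 2 * (1 - V.info) ^ 2 := by positivity
  rw [Real.rpow_two, Real.rpow_two, ge_iff_le]
  rcases (by decide : ∀ b : Fin 3, b = 0 ∨ b = 1 ∨ b = 2) b with rfl | rfl | rfl
  · refine le_trans ?_ (neg_le_abs _)
    rw [V.info_sub_kernelT3_zero]
    linarith
  · refine le_trans ?_ (le_abs_self _)
    rw [V.info_sub_kernelT3_one]
    linarith
  · refine le_trans ?_ (le_abs_self _)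
    rw [V.info_sub_kernelT3_two]
    linarith

end

theorem mainTheorem3 :
    -- the polarization inequalities, for all indices and all past sequences
    PolarizationInequality.{u} kernelT2 1 2 ∧
    PolarizationInequality.{u} kernelT3 2 2 ∧
    -- the entropy inequality for `T_2`
    (∀ W : BinChannel.{u},
      condEntropy (W.vectorLaw kernelT2)
          (fun ω => chanInput kernelT2 0 ω + chanInput kernelT2 1 ω) Prod.snd
        - W.inputEntropy ≥ W.inputEntropy ^ 2 * (1 - W.inputEntropy)) ∧
    -- the two entropy inequalities for `T_3`
    (∀ W : BinChannel.{u},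
      |condEntropy (W.vectorLaw kernelT3)
          (fun ω => chanInput kernelT3 0 ω + chanInput kernelT3 1 ω + chanInput kernelT3 2 ω)
          Prod.snd
        - W.inputEntropy| ≥ W.inputEntropy ^ 2 * (1 - W.inputEntropy) ^ 2 ∧
      |condEntropy (W.vectorLaw kernelT3)
          (fun ω => chanInput kernelT3 1 ω + chanInput kernelT3 2 ω)
          (fun ω => (ω.2,
            chanInput kernelT3 0 ω + chanInput kernelT3 1 ω + chanInput kernelT3 2 ω))
        - W.inputEntropy| ≥ W.inputEntropy ^ 2 * (1 - W.inputEntropy) ^ 2) := by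
  refine ⟨polarizationInequality_kernelT2, polarizationInequality_kernelT3, fun W => ?_,
    fun W => ?_⟩
  · have h := W.xorInfo_le_info_sub
    simp only [chanInput_kernelT2_add]
    rw [W.condEntropy_snd, W.condEntropy_kernelT2_zero]
    -- Since I = 1 - H₀, the bound I (1 - I)² on I - J₂ becomes (1 - H₀) H₀².
    rw [W.info_eq_one_sub_inputEntropy, sub_sub_cancel] at h
    linarith
  · have h := W.xorInfo_le_info_sub
    have h' := W.tripleXorInfo_le_xorInfo_sub
    have h'' := W.info_sq_mul_le
    have h0 : 0 ≤ W.inputEntropy ^ 2 * (1 - W.inputEntropy) ^ 2 := by positivity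
    simp only [chanInput_kernelT3_add, chanInput_kernelT3_one_add_two]
    rw [W.condEntropy_snd, W.condEntropy_kernelT3_zero, W.condEntropy_kernelT3_one]
    rw [W.info_eq_one_sub_inputEntropy, sub_sub_cancel] at h h' h''
    constructor
    · refine le_trans ?_ (le_abs_self _)
      linarith
    · refine le_trans ?_ (neg_le_abs _)
      linarith
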